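/- Let $d\ge 0$, $R>0$, $\lambda>0$ and $B(0,R)=\{x\in\mathbb{R}^d:\|x\|\le R\}$. Let $\mu_1,\dots,\mu_m$ and $\nu$ be Borel probability measures on $\mathbb{R}^d$ with supports contained in $B(0,R)$. For $\theta$ in the simplex $\Sigma_m=\{\theta\in\mathbb{R}_+^m:\sum_k\theta_k=1\}$ put $\mu_\theta=\sum_{k=1}^m\theta_k\mu_k$. A pair $(\varphi,\psi)\in L^\infty(\mu_\theta)\times L^\infty(\nu)$ is called a pair of dual potentials for $W_\lambda(\mu_\theta,\nu)$ if it maximizes the dual objective of entropic optimal transport $$(f,g)\mapsto\int f\,d\mu_\theta+\int g\,d\nu-\int\lambda\Big(e^{(f(x)+g(y)-\|x-y\|^2)/\lambda}-1\Big)\,d\mu_\theta(x)\,d\nu(y)$$ over $L^\infty(\mu_\theta)\times L^\infty(\nu)$. The regularized $c$-transform of $\varphi$ with respect to $\mu_\theta$ is $$\varphi^{c,\lambda}_{\mu_\theta}(y)=-\lambda\log\int e^{-(\|x-y\|^2-\varphi(x))/\lambda}\,d\mu_\theta(x),\qquad y\in B(0,R),$$ and $\|f\|_{\mathscr K}=\max_{|\kappa|\le\mathscr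 K}\sup_{y\in B(0,R)}|\partial^\kappa f(y)|$, with multi-indices $\kappa\in\mathbb{N}^d$. There are constants $M_{\mathscr K}>0$, $\mathscr K\in\mathbb{N}$, with $M_{\mathscr K}$ depending only on $\mathscr K$ (not on $d,m,R,\lambda,\mu_1,\dots,\mu_m,\nu,\theta$), such that in every situation as above and for every $\theta\in\Sigma_m$: 1. There is a pair $(\varphi,\psi)$ of dual potentials for $W_\lambda(\mu_\theta,\nu)$ with $\psi(0)=0$ and $\psi=\varphi^{c,\lambda}_{\mu_\theta}$ on $B(0,R)$. 2. For every such pair, $\psi$ is $C^\infty$ on $B(0,R)$, and for every integer $\mathscr K\ge 1$, $$\|\psi\|_{\mathscr K}\le M_{\mathscr K}\max\Big(R^2,\frac{R^{\mathscr K}}{\lambda^{\mathscr K-1}}\Big),$$ provided, in case $\mathscr K\ge 2$, that $R^2\ge\min(1,\lambda)$. -/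

import Mathlib

open MeasureTheory Metric
open scoped ENNReal ContDiff

namespace EntropicOT

/-- The re-weighted mixture `μ_θ = ∑ k, θ k • μ k`. -/
noncomputable def mixture {d m : ℕ} (μ : Fin m → Measure (EuclideanSpace ℝ (Fin d)))
    (θ : Fin m → ℝ) : Measure (EuclideanSpace ℝ (Fin d)) :=
  ∑ k, ENNReal.ofReal (θ k) • μ k

/-- The objective of the dual problem of entropic optimal transport, for the quadratic cost and
`0 < lam`:
`∫ φ dμ + ∫ ψ dν - ∫ lam * (exp ((φ x + ψ y - ‖x - y‖²) / lam) - 1) d(μ ⊗ ν)`. -/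
noncomputable def dualObjective {d : ℕ} (lam : ℝ) (μ ν : Measure (EuclideanSpace ℝ (Fin d)))
    (φ ψ : EuclideanSpace ℝ (Fin d) → ℝ) : ℝ :=
  ∫ x, φ x ∂μ + ∫ y, ψ y ∂ν
    - ∫ z, lam * (Real.exp ((φ z.1 + ψ z.2 - ‖z.1 - z.2‖ ^ 2) / lam) - 1) ∂(μ.prod ν)

/-- `(φ, ψ)` is a pair of (entropic) Kantorovich potentials for `W_lam(μ, ν)`: a solution of the
dual problem, i.e. a maximizer of the dual objective over `L^∞(μ) × L^∞(ν)`. -/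
structure IsDualPotentials {d : ℕ} (lam : ℝ) (μ ν : Measure (EuclideanSpace ℝ (Fin d)))
    (φ ψ : EuclideanSpace ℝ (Fin d) → ℝ) : Prop where
  memLp_left : MemLp φ ∞ μ
  memLp_right : MemLp ψ ∞ ν
  isMax : ∀ f g : EuclideanSpace ℝ (Fin d) → ℝ, MemLp f ∞ μ → MemLp g ∞ ν →
    dualObjective lam μ ν f g ≤ dualObjective lam μ ν φ ψ

/-- The regularized `c`-transform of `φ` with respect to `μ`, for the quadratic cost. -/
noncomputable def cTransform {d : ℕ} (lam : ℝ) (μ : Measure (EuclideanSpace ℝ (Fin d)))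
    (φ : EuclideanSpace ℝ (Fin d) → ℝ) (y : EuclideanSpace ℝ (Fin d)) : ℝ :=
  -lam * Real.log (∫ x, Real.exp (-(‖x - y‖ ^ 2 - φ x) / lam) ∂μ)

/-- The `i`-th partial derivative of `f` on the set `s` (taken within `s`, so that it makes sense up
to the boundary of a closed ball). -/
noncomputable def partialWithin {d : ℕ} (s : Set (EuclideanSpace ℝ (Fin d))) (i : Fin d)
    (f : EuclideanSpace ℝ (Fin d) → ℝ) (y : EuclideanSpace ℝ (Fin d)) : ℝ :=
  fderivWithin ℝ f s y (EuclideanSpace.single i 1)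

/-- The iterated partial derivative `∂^κ f = ∂₁^{κ₁} ⋯ ∂_d^{κ_d} f` on the set `s`. -/
noncomputable def multiPartialWithin {d : ℕ} (s : Set (EuclideanSpace ℝ (Fin d)))
    (κ : Fin d → ℕ) (f : EuclideanSpace ℝ (Fin d) → ℝ) : EuclideanSpace ℝ (Fin d) → ℝ :=
  (List.finRange d).foldr (fun i g => (partialWithin s i)^[κ i] g) f

/-- The norm `‖f‖_K = max_{|κ| ≤ K} sup_{y ∈ s} |∂^κ f y|`, with values in `[0, ∞]`. -/
noncomputable def ckNorm {d : ℕ} (s : Set (EuclideanSpace ℝ (Fin d))) (K : ℕ)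
    (f : EuclideanSpace ℝ (Fin d) → ℝ) : ℝ≥0∞ :=
  ⨆ (κ : Fin d → ℕ) (_ : ∑ i, κ i ≤ K) (y ∈ s), ‖multiPartialWithin s κ f y‖ₑ

end EntropicOT

/-! Regularity comes from the formula for the c-transform. Expanding the square gives
`cTransform_eq`: up to a constant, ψ(y) is ‖y‖² minus λ times the log-Laplace transform of a tilted
probability measure, with exponent ⟪2x/λ, y⟫. Its gradient is 2y minus λ times a Gibbs mean of 2x/λ,
a vector of norm at most B = 2R/λ. The derivative of a Gibbs mean is a covariance, hence built from
Gibbs means again (`hasFDerivAt_gibbsMean`). Induction with the Leibniz rule bounds the n-th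
derivative by c_n Bⁿ sup‖h‖, where c_n depends on n only (`norm_iteratedFDeriv_gibbsMean_le`).
Working with operator norms of multilinear maps keeps the dimension out. So derivatives of ψ of
order k ≥ 2 are at most 2 + c λ(2R/λ)^k; the gradient is at most 4R on the ball, and ψ(0) = 0 then
gives |ψ| ≤ 4R². The condition R² ≥ min(1, λ) absorbs the 2 and the lower orders into the maximum.
Existence is the direct method for the semi-dual functional: c-transforms are 4R-Lipschitz on the
ball, so after normalization at 0 the competitors lie in an Arzelà–Ascoli compact set
(`exists_isMaxOn_semiDual`, `exists_isDualPotentials`). -/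

namespace EntropicOT

/-! ### Gibbs means and their first derivative -/

section GibbsMean

variable {Ω : Type*} [MeasurableSpace Ω] {E : Type*} [NormedAddCommGroup E]
  [InnerProductSpace ℝ E] {F : Type*} [NormedAddCommGroup F] [NormedSpace ℝ F]
  {ρ : Measure Ω} {X : Ω → E} {B : ℝ}

/-- The mean of `h` under the probability measure with density proportional to
`exp ⟪X s, y⟫` with respect to `ρ`. -/
noncomputable def gibbsMean (ρ : Measure Ω) (X : Ω → E) (h : Ω → F) (y : E) : F :=
  (∫ s, Real.exp (inner ℝ (X s) y) ∂ρ)⁻¹ • ∫ s, Real.exp (inner ℝ (X s) y) • h s ∂ρ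

theorem aestronglyMeasurable_exp_inner (hX : AEStronglyMeasurable X ρ) (y : E) :
    AEStronglyMeasurable (fun s => Real.exp (inner ℝ (X s) y)) ρ :=
  Real.continuous_exp.comp_aestronglyMeasurable (hX.inner aestronglyMeasurable_const)

theorem exp_inner_le {x y : E} (hx : ‖x‖ ≤ B) :
    Real.exp (inner ℝ x y) ≤ Real.exp (B * ‖y‖) :=
  Real.exp_le_exp.2 ((real_inner_le_norm x y).trans (by gcongr))

theorem integrable_exp_inner_smul [IsFiniteMeasure ρ] (hX : AEStronglyMeasurable X ρ)
    (hB : ∀ᵐ s ∂ρ, ‖X s‖ ≤ B) {h : Ω → F} {H : ℝ} (hh : AEStronglyMeasurable h ρ)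
    (hH : ∀ᵐ s ∂ρ, ‖h s‖ ≤ H) (y : E) :
    Integrable (fun s => Real.exp (inner ℝ (X s) y) • h s) ρ := by
  refine Integrable.of_bound ((aestronglyMeasurable_exp_inner hX y).smul hh)
    (Real.exp (B * ‖y‖) * H) ?_
  filter_upwards [hB, hH] with s h1 h2
  rw [norm_smul, Real.norm_of_nonneg (Real.exp_pos _).le]
  exact mul_le_mul (exp_inner_le h1) h2 (norm_nonneg _) (Real.exp_pos _).le

theorem integrable_exp_inner [IsFiniteMeasure ρ] (hX : AEStronglyMeasurable X ρ)
    (hB : ∀ᵐ s ∂ρ, ‖X s‖ ≤ B) (y : E) :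
    Integrable (fun s => Real.exp (inner ℝ (X s) y)) ρ := by
  simpa using integrable_exp_inner_smul hX hB (h := fun _ => (1 : ℝ)) (H := 1)
    aestronglyMeasurable_const (by simp) y

theorem integral_exp_inner_pos [IsFiniteMeasure ρ] [NeZero ρ] (hX : AEStronglyMeasurable X ρ)
    (hB : ∀ᵐ s ∂ρ, ‖X s‖ ≤ B) (y : E) : 0 < ∫ s, Real.exp (inner ℝ (X s) y) ∂ρ :=
  integral_exp_pos (integrable_exp_inner hX hB y)

theorem aestronglyMeasurable_innerSL (hX : AEStronglyMeasurable X ρ) :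
    AEStronglyMeasurable (fun s => innerSL ℝ (X s)) ρ :=
  (innerSL ℝ).continuous.comp_aestronglyMeasurable hX

theorem aestronglyMeasurable_smulRight (hX : AEStronglyMeasurable X ρ) {h : Ω → F}
    (hh : AEStronglyMeasurable h ρ) :
    AEStronglyMeasurable (fun s => (innerSL ℝ (X s)).smulRight (h s)) ρ :=
  (ContinuousLinearMap.smulRightL ℝ E F).aestronglyMeasurable_comp₂
    (aestronglyMeasurable_innerSL hX) hh

theorem norm_innerSL_smulRight_le (hB : ∀ᵐ s ∂ρ, ‖X s‖ ≤ B) {h : Ω → F} {H : ℝ}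
    (hH : ∀ᵐ s ∂ρ, ‖h s‖ ≤ H) :
    ∀ᵐ s ∂ρ, ‖(innerSL ℝ (X s)).smulRight (h s)‖ ≤ B * H := by
  filter_upwards [hB, hH] with s h1 h2
  rw [ContinuousLinearMap.norm_smulRight_apply, innerSL_apply_norm]
  exact mul_le_mul h1 h2 (norm_nonneg _) ((norm_nonneg _).trans h1)

/-- Differentiation under the integral sign: on the unit ball around `y` the exponential is at most
`exp (B * (‖y‖ + 1))`, a constant and so integrable bound. -/
theorem hasFDerivAt_integral_exp_inner_smul [IsFiniteMeasure ρ] (hX : AEStronglyMeasurable X ρ)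
    (hB : ∀ᵐ s ∂ρ, ‖X s‖ ≤ B) {h : Ω → F} {H : ℝ} (hh : AEStronglyMeasurable h ρ)
    (hH : ∀ᵐ s ∂ρ, ‖h s‖ ≤ H) (y : E) :
    HasFDerivAt (fun y => ∫ s, Real.exp (inner ℝ (X s) y) • h s ∂ρ)
      (∫ s, Real.exp (inner ℝ (X s) y) • (innerSL ℝ (X s)).smulRight (h s) ∂ρ) y := by
  refine hasFDerivAt_integral_of_dominated_of_fderiv_le (s := ball y (1 : ℝ))
    (bound := fun _ => Real.exp (B * (‖y‖ + 1)) * (B * H))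
    (F' := fun y s => Real.exp (inner ℝ (X s) y) • (innerSL ℝ (X s)).smulRight (h s))
    (ball_mem_nhds y one_pos)
    (Filter.Eventually.of_forall fun z => (aestronglyMeasurable_exp_inner hX z).smul hh)
    (integrable_exp_inner_smul hX hB hh hH y)
    ((aestronglyMeasurable_exp_inner hX y).smul (aestronglyMeasurable_smulRight hX hh))
    ?_ (integrable_const _) ?_
  · filter_upwards [norm_innerSL_smulRight_le hB hH, hB] with s h1 h2 z hz
    have hz' : ‖z‖ ≤ ‖y‖ + 1 := by
      have : ‖z - y‖ < 1 := by simpa [dist_eq_norm] using hz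
      linarith [norm_le_norm_add_norm_sub' z y]
    rw [norm_smul, Real.norm_of_nonneg (Real.exp_pos _).le]
    refine mul_le_mul ((exp_inner_le h2).trans (Real.exp_le_exp.2 ?_)) h1 (norm_nonneg _)
      (Real.exp_pos _).le
    exact mul_le_mul_of_nonneg_left hz' ((norm_nonneg _).trans h2)
  · refine Filter.Eventually.of_forall fun s z _ => ?_
    have h1 : HasFDerivAt (fun y => Real.exp (inner ℝ (X s) y))
        (Real.exp (inner ℝ (X s) z) • innerSL ℝ (X s)) z :=
      (innerSL ℝ (X s)).hasFDerivAt.exp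
    convert! h1.smul_const (h s) using 1
    ext v
    simp [smul_smul]

theorem hasFDerivAt_integral_exp_inner [IsFiniteMeasure ρ] (hX : AEStronglyMeasurable X ρ)
    (hB : ∀ᵐ s ∂ρ, ‖X s‖ ≤ B) (y : E) :
    HasFDerivAt (fun y => ∫ s, Real.exp (inner ℝ (X s) y) ∂ρ)
      (∫ s, Real.exp (inner ℝ (X s) y) • innerSL ℝ (X s) ∂ρ) y := by
  have key := hasFDerivAt_integral_exp_inner_smul hX hB (h := fun _ => (1 : ℝ)) (H := 1)
    aestronglyMeasurable_const (by simp) y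
  have h1 : ∀ s, (innerSL ℝ (X s)).smulRight (1 : ℝ) = innerSL ℝ (X s) := fun s => by
    ext; simp
  simpa [h1] using key

/-- Quotient rule: the derivative is the Gibbs covariance ⟨X ⊗ h⟩ - ⟨X⟩ ⊗ ⟨h⟩. Only Gibbs means of
bounded functions appear, so the formula can be iterated. -/
theorem hasFDerivAt_gibbsMean [IsFiniteMeasure ρ] [NeZero ρ] (hX : AEStronglyMeasurable X ρ)
    (hB : ∀ᵐ s ∂ρ, ‖X s‖ ≤ B) {h : Ω → F} {H : ℝ} (hh : AEStronglyMeasurable h ρ)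
    (hH : ∀ᵐ s ∂ρ, ‖h s‖ ≤ H) (y : E) :
    HasFDerivAt (gibbsMean ρ X h)
      (gibbsMean ρ X (fun s => (innerSL ℝ (X s)).smulRight (h s)) y -
        (gibbsMean ρ X (fun s => innerSL ℝ (X s)) y).smulRight (gibbsMean ρ X h y)) y := by
  have hpos := integral_exp_inner_pos hX hB y
  have h1 := (hasDerivAt_inv hpos.ne').comp_hasFDerivAt y (hasFDerivAt_integral_exp_inner hX hB y)
  convert! h1.smul (hasFDerivAt_integral_exp_inner_smul hX hB hh hH y) using 1
  ext v
  simp only [gibbsMean, sub_apply, add_apply,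
    smul_apply, ContinuousLinearMap.smulRight_apply, smul_eq_mul,
    Function.comp_apply, smul_smul]
  rw [sub_eq_add_neg, ← neg_smul]
  congr 2
  ring

theorem norm_gibbsMean_le [IsFiniteMeasure ρ] [NeZero ρ] (hX : AEStronglyMeasurable X ρ)
    (hB : ∀ᵐ s ∂ρ, ‖X s‖ ≤ B) {h : Ω → F} {H : ℝ} (hH : ∀ᵐ s ∂ρ, ‖h s‖ ≤ H) (y : E) :
    ‖gibbsMean ρ X h y‖ ≤ H := by
  have hpos := integral_exp_inner_pos hX hB y
  rw [gibbsMean, norm_smul, norm_inv, Real.norm_of_nonneg hpos.le, inv_mul_le_iff₀ hpos,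
    ← integral_mul_const]
  refine norm_integral_le_of_norm_le ((integrable_exp_inner hX hB y).mul_const H) ?_
  filter_upwards [hH] with s h1
  rw [norm_smul, Real.norm_of_nonneg (Real.exp_pos _).le]
  gcongr

/-- The constants in the bounds on the derivatives of `gibbsMean`. -/
noncomputable def gibbsConst : ℕ → ℝ
  | 0 => 1
  | n + 1 => gibbsConst n +
      ∑ i : Fin (n + 1), (n.choose i : ℝ) * gibbsConst i * gibbsConst (n - i)

/-- The definition sums over `Fin (n + 1)` to make the recursion visibly decreasing; the
`Finset.range` form matches the Leibniz rule. -/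
theorem gibbsConst_succ (n : ℕ) : gibbsConst (n + 1) = gibbsConst n +
    ∑ i ∈ Finset.range (n + 1), (n.choose i : ℝ) * gibbsConst i * gibbsConst (n - i) := by
  rw [gibbsConst, Fin.sum_univ_eq_sum_range
    (fun i => (n.choose i : ℝ) * gibbsConst i * gibbsConst (n - i))]

theorem gibbsConst_nonneg (n : ℕ) : 0 ≤ gibbsConst n := by
  induction n using Nat.strong_induction_on with
  | _ n ih =>
    cases n with
    | zero => simp [gibbsConst]
    | succ n =>
      rw [gibbsConst_succ]
      refine add_nonneg (ih n (by omega)) (Finset.sum_nonneg fun i hi => ?_)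
      rw [Finset.mem_range] at hi
      exact mul_nonneg (mul_nonneg (by positivity) (ih i hi)) (ih _ (by omega))

end GibbsMean

/-! ### Smoothness and higher derivative bounds for Gibbs means -/

section GibbsBounds

universe u

variable {Ω : Type*} [MeasurableSpace Ω] {E : Type u} [NormedAddCommGroup E]
  [InnerProductSpace ℝ E] {ρ : Measure Ω} {X : Ω → E} {B : ℝ}

theorem norm_innerSL_comp_le (hB : ∀ᵐ s ∂ρ, ‖X s‖ ≤ B) :
    ∀ᵐ s ∂ρ, ‖innerSL ℝ (X s)‖ ≤ B := by
  filter_upwards [hB] with s h1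
  rwa [innerSL_apply_norm]

/-- Induction through the covariance formula. `F` is quantified inside because the derivative takes
values in `E →L[ℝ] F`; `E` and `F` share a universe so that this space stays in it. -/
theorem contDiff_gibbsMean_nat [IsFiniteMeasure ρ] [NeZero ρ] (hX : AEStronglyMeasurable X ρ)
    (hB : ∀ᵐ s ∂ρ, ‖X s‖ ≤ B) (n : ℕ) : ∀ {F : Type u} [NormedAddCommGroup F] [NormedSpace ℝ F]
    {h : Ω → F} {H : ℝ}, AEStronglyMeasurable h ρ → (∀ᵐ s ∂ρ, ‖h s‖ ≤ H) →
    ContDiff ℝ n (gibbsMean ρ X h) := by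
  induction n with
  | zero =>
    intro F _ _ h H hh hH
    rw [Nat.cast_zero, contDiff_zero, continuous_iff_continuousAt]
    exact fun y => (hasFDerivAt_gibbsMean hX hB hh hH y).continuousAt
  | succ n ih =>
    intro F _ _ h H hh hH
    rw [Nat.cast_succ, contDiff_succ_iff_fderiv]
    refine ⟨fun y => (hasFDerivAt_gibbsMean hX hB hh hH y).differentiableAt, by simp, ?_⟩
    rw [funext fun y => (hasFDerivAt_gibbsMean hX hB hh hH y).fderiv]
    exact (ih (aestronglyMeasurable_smulRight hX hh) (norm_innerSL_smulRight_le hB hH)).sub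
      ((ih (aestronglyMeasurable_innerSL hX) (norm_innerSL_comp_le hB)).smulRight (ih hh hH))

theorem contDiff_gibbsMean [IsFiniteMeasure ρ] [NeZero ρ] (hX : AEStronglyMeasurable X ρ)
    (hB : ∀ᵐ s ∂ρ, ‖X s‖ ≤ B) {F : Type u} [NormedAddCommGroup F] [NormedSpace ℝ F]
    {h : Ω → F} {H : ℝ} (hh : AEStronglyMeasurable h ρ) (hH : ∀ᵐ s ∂ρ, ‖h s‖ ≤ H) :
    ContDiff ℝ ∞ (gibbsMean ρ X h) :=
  contDiff_infty.2 fun n => contDiff_gibbsMean_nat hX hB n hh hH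

/-- Derivatives of Gibbs means of bounded functions are bounded independently of the measure and
of the dimension. -/
theorem norm_iteratedFDeriv_gibbsMean_le [IsFiniteMeasure ρ] [NeZero ρ]
    (hX : AEStronglyMeasurable X ρ) (hB : ∀ᵐ s ∂ρ, ‖X s‖ ≤ B) (n : ℕ) :
    ∀ {F : Type u} [NormedAddCommGroup F] [NormedSpace ℝ F] {h : Ω → F} {H : ℝ},
      AEStronglyMeasurable h ρ → (∀ᵐ s ∂ρ, ‖h s‖ ≤ H) → ∀ y,
      ‖iteratedFDeriv ℝ n (gibbsMean ρ X h) y‖ ≤ gibbsConst n * B ^ n * H := by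
  induction n using Nat.strong_induction_on with
  | _ n ih =>
  intro F _ _ h H hh hH y
  -- Since `ρ` is nonzero some point satisfies both bounds, which forces `B` and `H` to be
  -- nonnegative.
  obtain ⟨s, hs⟩ := (hB.and hH).exists
  have hB0 : 0 ≤ B := (norm_nonneg _).trans hs.1
  have hH0 : 0 ≤ H := (norm_nonneg _).trans hs.2
  cases n with
  | zero => simpa [gibbsConst] using norm_gibbsMean_le hX hB hH y
  | succ n =>
    have hXm := aestronglyMeasurable_innerSL hX
    have hXB := norm_innerSL_comp_le hB
    have hm := aestronglyMeasurable_smulRight hX hh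
    have hb := norm_innerSL_smulRight_le hB hH
    have c1 := contDiff_gibbsMean hX hB hm hb
    have c2 := contDiff_gibbsMean hX hB hXm hXB
    have c3 := contDiff_gibbsMean hX hB hh hH
    have hn : ((n : ℕ∞) : WithTop ℕ∞) ≤ (∞ : WithTop ℕ∞) := by exact_mod_cast le_top
    rw [← norm_iteratedFDeriv_fderiv, funext fun y => (hasFDerivAt_gibbsMean hX hB hh hH y).fderiv]
    have c4 : ContDiff ℝ ∞ (fun y => (gibbsMean ρ X (fun s => innerSL ℝ (X s)) y).smulRight
        (gibbsMean ρ X h y)) := c2.smulRight c3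
    rw [fun_iteratedFDeriv_sub (c1.of_le hn) (c4.of_le hn)]
    refine (norm_sub_le _ _).trans ?_
    rw [gibbsConst_succ, add_mul, add_mul, Finset.sum_mul, Finset.sum_mul]
    -- The term ⟨X ⊗ h⟩ is a Gibbs mean with bound `B * H` and gives `gibbsConst n`; the product ⟨X⟩
    -- ⊗ ⟨h⟩ gives the binomial sum.
    refine add_le_add ((ih n (by omega) hm hb y).trans_eq (by ring)) ?_
    refine ((ContinuousLinearMap.smulRightL ℝ E F).norm_iteratedFDeriv_le_of_bilinear_of_le_one
      c2 c3 y hn ContinuousLinearMap.norm_smulRightL_le).trans (Finset.sum_le_sum fun i hi => ?_)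
    rw [Finset.mem_range] at hi
    have e1 := ih i hi hXm hXB y
    have e2 := ih (n - i) (by omega) hh hH y
    calc _ ≤ (n.choose i : ℝ) * (gibbsConst i * B ^ i * B) *
            (gibbsConst (n - i) * B ^ (n - i) * H) := by
          exact mul_le_mul (mul_le_mul_of_nonneg_left e1 (by positivity)) e2 (norm_nonneg _)
            (mul_nonneg (by positivity)
              (mul_nonneg (mul_nonneg (gibbsConst_nonneg _) (by positivity)) hB0))
      _ = (n.choose i : ℝ) * gibbsConst i * gibbsConst (n - i) * (B ^ (i + (n - i)) * B) * H := by
          ring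
      _ = _ := by rw [show i + (n - i) = n by omega, ← pow_succ]

end GibbsBounds

end EntropicOT

namespace EntropicOT

/-! ### The c-transform as a log-Laplace transform -/

section CTransform

variable {d : ℕ} {R lam : ℝ} {μ : Measure (EuclideanSpace ℝ (Fin d))}
  {φ : EuclideanSpace ℝ (Fin d) → ℝ}

/-- Essentially bounded functions are bounded almost everywhere by a real number. -/
theorem exists_ae_norm_le {α : Type*} [MeasurableSpace α] {μ : Measure α} {φ : α → ℝ}
    (hφ : MemLp φ ∞ μ) : ∃ C, ∀ᵐ x ∂μ, ‖φ x‖ ≤ C := by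
  refine ⟨(eLpNorm φ ∞ μ).toReal, ?_⟩
  have h := ae_le_eLpNormEssSup (f := φ) (μ := μ)
  rw [← eLpNorm_exponent_top] at h
  filter_upwards [h] with x hx
  rw [← toReal_enorm]
  exact ENNReal.toReal_mono hφ.2.ne hx

theorem integrable_exp_cost [IsFiniteMeasure μ] (hlam : 0 < lam) (hφ : MemLp φ ∞ μ)
    (y : EuclideanSpace ℝ (Fin d)) :
    Integrable (fun x => Real.exp (-(‖x - y‖ ^ 2 - φ x) / lam)) μ := by
  obtain ⟨C, hC⟩ := exists_ae_norm_le hφ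
  have hm : AEStronglyMeasurable (fun x => -(‖x - y‖ ^ 2 - φ x) / lam) μ := by
    have h1 : AEStronglyMeasurable (fun x : EuclideanSpace ℝ (Fin d) => ‖x - y‖ ^ 2) μ :=
      (by fun_prop : Continuous fun x : EuclideanSpace ℝ (Fin d) =>
        ‖x - y‖ ^ 2).aestronglyMeasurable
    exact ((h1.sub hφ.1).neg.aemeasurable.div_const lam).aestronglyMeasurable
  refine Integrable.of_bound (Real.continuous_exp.comp_aestronglyMeasurable hm)
    (Real.exp (C / lam)) ?_
  filter_upwards [hC] with x hx
  rw [Real.norm_of_nonneg (Real.exp_pos _).le, Real.exp_le_exp]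
  rw [Real.norm_eq_abs] at hx
  gcongr
  nlinarith [le_abs_self (φ x), sq_nonneg ‖x - y‖]

/-- The logarithm of the density of the measure whose Laplace transform gives the
regularized `c`-transform of `φ`. -/
noncomputable def tiltWeight (lam : ℝ) (φ : EuclideanSpace ℝ (Fin d) → ℝ)
    (x : EuclideanSpace ℝ (Fin d)) : ℝ :=
  -(‖x‖ ^ 2 - φ x) / lam

theorem integrable_exp_tiltWeight [IsFiniteMeasure μ] (hlam : 0 < lam) (hφ : MemLp φ ∞ μ) :
    Integrable (fun x => Real.exp (tiltWeight lam φ x)) μ := by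
  simpa [tiltWeight] using integrable_exp_cost hlam hφ 0

/-- Expanding ‖x - y‖² leaves the cross term as the only coupling between `x` and `y`. -/
theorem exp_cost_eq (hlam : 0 < lam) (x y : EuclideanSpace ℝ (Fin d)) :
    Real.exp (-(‖x - y‖ ^ 2 - φ x) / lam) = Real.exp (-‖y‖ ^ 2 / lam) *
      (Real.exp (tiltWeight lam φ x) * Real.exp (inner ℝ ((2 / lam) • x) y)) := by
  rw [← Real.exp_add, ← Real.exp_add, tiltWeight, norm_sub_sq_real, real_inner_smul_left]
  congr 1
  field_simp
  ring

theorem aestronglyMeasurable_smul_tilted (a : ℝ) :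
    AEStronglyMeasurable (fun x : EuclideanSpace ℝ (Fin d) => a • x)
      (μ.tilted (tiltWeight lam φ)) :=
  (continuous_const_smul a).aestronglyMeasurable

theorem norm_smul_tilted_le (hlam : 0 < lam) (hR : ∀ᵐ x ∂μ, ‖x‖ ≤ R) :
    ∀ᵐ x ∂(μ.tilted (tiltWeight lam φ)), ‖(2 / lam) • x‖ ≤ 2 / lam * R := by
  filter_upwards [tilted_absolutelyContinuous μ _ hR] with x hx
  rw [norm_smul, Real.norm_of_nonneg (by positivity)]
  gcongr

theorem isProbabilityMeasure_tiltWeight [IsProbabilityMeasure μ] (hlam : 0 < lam)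
    (hφ : MemLp φ ∞ μ) : IsProbabilityMeasure (μ.tilted (tiltWeight lam φ)) :=
  isProbabilityMeasure_tilted (integrable_exp_tiltWeight hlam hφ)

theorem integral_exp_cost_eq [IsProbabilityMeasure μ] (hlam : 0 < lam) (hφ : MemLp φ ∞ μ)
    (y : EuclideanSpace ℝ (Fin d)) :
    ∫ x, Real.exp (-(‖x - y‖ ^ 2 - φ x) / lam) ∂μ = Real.exp (-‖y‖ ^ 2 / lam) *
      ((∫ x, Real.exp (tiltWeight lam φ x) ∂μ) *
        ∫ x, Real.exp (inner ℝ ((2 / lam) • x) y) ∂(μ.tilted (tiltWeight lam φ))) := by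
  have hpos := integral_exp_pos (integrable_exp_tiltWeight hlam hφ)
  simp_rw [exp_cost_eq hlam, integral_const_mul, integral_tilted, smul_eq_mul, div_mul_eq_mul_div,
    integral_div]
  field_simp

theorem cTransform_eq [IsProbabilityMeasure μ] (hlam : 0 < lam) (hR : ∀ᵐ x ∂μ, ‖x‖ ≤ R)
    (hφ : MemLp φ ∞ μ) (y : EuclideanSpace ℝ (Fin d)) :
    cTransform lam μ φ y = ‖y‖ ^ 2 - lam * Real.log (∫ x, Real.exp (tiltWeight lam φ x) ∂μ) -
      lam * Real.log
        (∫ x, Real.exp (inner ℝ ((2 / lam) • x) y) ∂(μ.tilted (tiltWeight lam φ))) := by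
  have := isProbabilityMeasure_tiltWeight hlam hφ
  have h1 := integral_exp_pos (integrable_exp_tiltWeight hlam hφ)
  have h2 := integral_exp_inner_pos (aestronglyMeasurable_smul_tilted (2 / lam))
    (norm_smul_tilted_le (φ := φ) hlam hR) y
  rw [cTransform, integral_exp_cost_eq hlam hφ, Real.log_mul (Real.exp_ne_zero _) (by positivity),
    Real.log_mul h1.ne' h2.ne', Real.log_exp]
  field_simp
  ring

theorem hasFDerivAt_cTransform [IsProbabilityMeasure μ] (hlam : 0 < lam)
    (hR : ∀ᵐ x ∂μ, ‖x‖ ≤ R) (hφ : MemLp φ ∞ μ) (y : EuclideanSpace ℝ (Fin d)) :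
    HasFDerivAt (cTransform lam μ φ) ((2 : ℝ) • innerSL ℝ y -
      lam • gibbsMean (μ.tilted (tiltWeight lam φ)) (fun x => (2 / lam) • x)
        (fun x => innerSL ℝ ((2 / lam) • x)) y) y := by
  have := isProbabilityMeasure_tiltWeight hlam hφ
  have hX := aestronglyMeasurable_smul_tilted (μ := μ) (φ := φ) (lam := lam) (2 / lam)
  have hB := norm_smul_tilted_le (φ := φ) hlam hR
  have h2 := integral_exp_inner_pos hX hB y
  rw [funext (cTransform_eq hlam hR hφ)]
  have h3 := (hasFDerivAt_integral_exp_inner hX hB y).log h2.ne'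
  have h4 := (hasStrictFDerivAt_norm_sq y).hasFDerivAt
  convert! (h4.sub_const _).sub (h3.const_mul lam) using 1
  ext v
  simp [two_smul, gibbsMean]

theorem contDiff_cTransform [IsProbabilityMeasure μ] (hlam : 0 < lam)
    (hR : ∀ᵐ x ∂μ, ‖x‖ ≤ R) (hφ : MemLp φ ∞ μ) : ContDiff ℝ ∞ (cTransform lam μ φ) := by
  have := isProbabilityMeasure_tiltWeight hlam hφ
  have hX := aestronglyMeasurable_smul_tilted (μ := μ) (φ := φ) (lam := lam) (2 / lam)
  have hB := norm_smul_tilted_le (φ := φ) hlam hR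
  rw [contDiff_infty_iff_fderiv]
  refine ⟨fun y => (hasFDerivAt_cTransform hlam hR hφ y).differentiableAt, ?_⟩
  rw [funext fun y => (hasFDerivAt_cTransform hlam hR hφ y).fderiv]
  exact ((innerSL ℝ).contDiff.const_smul (2 : ℝ)).sub
    ((contDiff_gibbsMean hX hB (aestronglyMeasurable_innerSL hX)
      (norm_innerSL_comp_le hB)).const_smul lam)

/-- Here 4R = 2R + 2R: one part from the gradient 2y of ‖y‖², the other from λ times a Gibbs mean of
norm at most 2R/λ. -/
theorem norm_fderiv_cTransform_le [IsProbabilityMeasure μ] (hlam : 0 < lam)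
    (hR : ∀ᵐ x ∂μ, ‖x‖ ≤ R) (hφ : MemLp φ ∞ μ) {y : EuclideanSpace ℝ (Fin d)} (hy : ‖y‖ ≤ R) :
    ‖fderiv ℝ (cTransform lam μ φ) y‖ ≤ 4 * R := by
  have := isProbabilityMeasure_tiltWeight hlam hφ
  have hX := aestronglyMeasurable_smul_tilted (μ := μ) (φ := φ) (lam := lam) (2 / lam)
  have hB := norm_smul_tilted_le (φ := φ) hlam hR
  rw [(hasFDerivAt_cTransform hlam hR hφ y).fderiv]
  refine (norm_sub_le _ _).trans ?_
  rw [norm_smul, norm_smul, innerSL_apply_norm, Real.norm_of_nonneg hlam.le,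
    Real.norm_of_nonneg zero_le_two]
  have h1 := mul_le_mul_of_nonneg_left
    (norm_gibbsMean_le hX hB (norm_innerSL_comp_le hB) y) hlam.le
  have h2 : lam * (2 / lam * R) = 2 * R := by field_simp
  linarith

theorem abs_cTransform_sub_le [IsProbabilityMeasure μ] (hlam : 0 < lam)
    (hR : ∀ᵐ x ∂μ, ‖x‖ ≤ R) (hφ : MemLp φ ∞ μ) {y z : EuclideanSpace ℝ (Fin d)} (hy : ‖y‖ ≤ R)
    (hz : ‖z‖ ≤ R) : |cTransform lam μ φ y - cTransform lam μ φ z| ≤ 4 * R * ‖y - z‖ :=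
  (convex_closedBall (0 : EuclideanSpace ℝ (Fin d)) R).norm_image_sub_le_of_norm_fderiv_le (𝕜 := ℝ)
    (fun x _ => (hasFDerivAt_cTransform hlam hR hφ x).differentiableAt)
    (fun _ hx => norm_fderiv_cTransform_le hlam hR hφ (mem_closedBall_zero_iff.1 hx))
    (mem_closedBall_zero_iff.2 hz) (mem_closedBall_zero_iff.2 hy)

/-- The summand 2 bounds the Hessian of ‖y‖² and is needed only for n = 0. The rest is λ c_{n+1}
B^{n+1} · B with B = 2R/λ. -/
theorem norm_iteratedFDeriv_cTransform_le [IsProbabilityMeasure μ] (hlam : 0 < lam)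
    (hR : ∀ᵐ x ∂μ, ‖x‖ ≤ R) (hφ : MemLp φ ∞ μ) (n : ℕ) (y : EuclideanSpace ℝ (Fin d)) :
    ‖iteratedFDeriv ℝ (n + 2) (cTransform lam μ φ) y‖ ≤
      2 + gibbsConst (n + 1) * 2 ^ (n + 2) * (R ^ (n + 2) / lam ^ (n + 1)) := by
  have := isProbabilityMeasure_tiltWeight hlam hφ
  have hX := aestronglyMeasurable_smul_tilted (μ := μ) (φ := φ) (lam := lam) (2 / lam)
  have hB := norm_smul_tilted_le (φ := φ) hlam hR
  have hn : (((n + 1 : ℕ) : ℕ∞) : WithTop ℕ∞) ≤ (∞ : WithTop ℕ∞) := by exact_mod_cast le_top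
  have c1 : ContDiff ℝ ∞ (fun y : EuclideanSpace ℝ (Fin d) => (2 : ℝ) • innerSL ℝ y) :=
    (innerSL ℝ).contDiff.const_smul (2 : ℝ)
  have c2 := contDiff_gibbsMean hX hB (aestronglyMeasurable_innerSL hX) (norm_innerSL_comp_le hB)
  have c3 := c2.const_smul lam
  rw [show n + 2 = (n + 1) + 1 from rfl, ← norm_iteratedFDeriv_fderiv,
    funext fun y => (hasFDerivAt_cTransform hlam hR hφ y).fderiv,
    fun_iteratedFDeriv_sub (c1.of_le hn) (c3.of_le hn)]
  refine (norm_sub_le _ _).trans (add_le_add ?_ ?_)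
  · rw [← norm_iteratedFDeriv_fderiv]
    have h1 : fderiv ℝ (fun y : EuclideanSpace ℝ (Fin d) => (2 : ℝ) • innerSL ℝ y) =
        fun _ => (2 : ℝ) • (innerSL ℝ : EuclideanSpace ℝ (Fin d) →L[ℝ] _) :=
      funext fun y => ((innerSL ℝ).hasFDerivAt.const_smul (2 : ℝ)).fderiv
    rw [h1]
    rcases Nat.eq_zero_or_pos n with rfl | hpos
    · rw [norm_iteratedFDeriv_zero, norm_smul, Real.norm_of_nonneg zero_le_two]
      have : ‖(innerSL ℝ : EuclideanSpace ℝ (Fin d) →L[ℝ] _)‖ ≤ 1 :=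
        ContinuousLinearMap.opNorm_le_bound _ zero_le_one fun x => by
          rw [innerSL_apply_norm, one_mul]
      linarith
    · rw [iteratedFDeriv_const_of_ne hpos.ne']
      simp
  · rw [iteratedFDeriv_const_smul_apply' (c2.of_le hn).contDiffAt, norm_smul,
      Real.norm_of_nonneg hlam.le]
    refine (mul_le_mul_of_nonneg_left (norm_iteratedFDeriv_gibbsMean_le hX hB (n + 1)
      (aestronglyMeasurable_innerSL hX) (norm_innerSL_comp_le hB) y) hlam.le).trans_eq ?_
    rw [mul_pow, div_pow]
    field_simp
    ring

end CTransform

/-! ### Iterated partial derivatives within a set -/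

section MultiPartial

variable {d : ℕ} {s : Set (EuclideanSpace ℝ (Fin d))} {f g : EuclideanSpace ℝ (Fin d) → ℝ}

theorem contDiff_fderiv_apply (hf : ContDiff ℝ ∞ f) (v : EuclideanSpace ℝ (Fin d)) :
    ContDiff ℝ ∞ (fun y => fderiv ℝ f y v) :=
  (contDiff_infty_iff_fderiv.1 hf).2.clm_apply contDiff_const

theorem norm_iteratedFDeriv_fderiv_apply_le (hf : ContDiff ℝ ∞ f)
    {v : EuclideanSpace ℝ (Fin d)} (hv : ‖v‖ ≤ 1) (n : ℕ) (y : EuclideanSpace ℝ (Fin d)) :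
    ‖iteratedFDeriv ℝ n (fun y => fderiv ℝ f y v) y‖ ≤ ‖iteratedFDeriv ℝ (n + 1) f y‖ := by
  have hn : ((n : ℕ∞) : WithTop ℕ∞) ≤ (∞ : WithTop ℕ∞) := by exact_mod_cast le_top
  rw [← norm_iteratedFDeriv_fderiv]
  refine (norm_iteratedFDeriv_clm_apply_const (contDiff_infty_iff_fderiv.1 hf).2.contDiffAt
    hn).trans ?_
  exact mul_le_of_le_one_left (norm_nonneg _) hv

/-- `g` is, on `s`, a smooth function whose `j`-th derivatives are bounded by the `(j + n)`-th
derivatives of `f`. -/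
def IsDerivedOn (s : Set (EuclideanSpace ℝ (Fin d))) (f : EuclideanSpace ℝ (Fin d) → ℝ) (n : ℕ)
    (g : EuclideanSpace ℝ (Fin d) → ℝ) : Prop :=
  ∃ g', ContDiff ℝ ∞ g' ∧ Set.EqOn g g' s ∧
    ∀ j y, ‖iteratedFDeriv ℝ j g' y‖ ≤ ‖iteratedFDeriv ℝ (j + n) f y‖

/-- Unique differentiability makes the derivative within `s` agree with the full derivative of the
smooth extension, and evaluating at a unit vector does not increase norms. -/
theorem IsDerivedOn.partialWithin (hs : UniqueDiffOn ℝ s) {n : ℕ} (h : IsDerivedOn s f n g)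
    (i : Fin d) : IsDerivedOn s f (n + 1) (partialWithin s i g) := by
  obtain ⟨g', h1, h2, h3⟩ := h
  refine ⟨fun y => fderiv ℝ g' y (EuclideanSpace.single i 1), contDiff_fderiv_apply h1 _, ?_, ?_⟩
  · intro y hy
    rw [EntropicOT.partialWithin, fderivWithin_congr h2 (h2 hy),
      fderivWithin_eq_fderiv (hs y hy) (h1.differentiable (by simp) y)]
  · intro j y
    refine (norm_iteratedFDeriv_fderiv_apply_le h1 (by simp) j y).trans ?_
    rw [add_comm n 1, ← add_assoc]
    exact h3 (j + 1) y

theorem IsDerivedOn.iterate_partialWithin (hs : UniqueDiffOn ℝ s) {n : ℕ}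
    (h : IsDerivedOn s f n g) (i : Fin d) (k : ℕ) :
    IsDerivedOn s f (n + k) ((EntropicOT.partialWithin s i)^[k] g) := by
  induction k with
  | zero => exact h
  | succ k ih =>
    rw [Function.iterate_succ_apply']
    exact ih.partialWithin hs i

theorem isDerivedOn_multiPartialWithin (hs : UniqueDiffOn ℝ s) (hf : ContDiff ℝ ∞ f)
    (hg : Set.EqOn g f s) (κ : Fin d → ℕ) :
    IsDerivedOn s f (∑ i, κ i) (multiPartialWithin s κ g) := by
  rw [← List.sum_ofFn, List.ofFn_eq_map, multiPartialWithin]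
  induction List.finRange d with
  | nil => exact ⟨f, hf, hg, fun j y => le_rfl⟩
  | cons i l ih =>
    rw [List.foldr_cons, List.map_cons, List.sum_cons, add_comm]
    exact ih.iterate_partialWithin hs i (κ i)

theorem norm_multiPartialWithin_le (hs : UniqueDiffOn ℝ s) (hf : ContDiff ℝ ∞ f)
    (hg : Set.EqOn g f s) (κ : Fin d → ℕ) {y : EuclideanSpace ℝ (Fin d)} (hy : y ∈ s) :
    ‖multiPartialWithin s κ g y‖ ≤ ‖iteratedFDeriv ℝ (∑ i, κ i) f y‖ := by
  obtain ⟨g', -, h2, h3⟩ := isDerivedOn_multiPartialWithin hs hf hg κ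
  have h4 := h3 0 y
  rw [zero_add] at h4
  simpa [h2 hy] using h4

end MultiPartial

/-! ### Comparison with the maximum in the final estimate -/

section Bounds

variable {d : ℕ} {R lam : ℝ} {μ : Measure (EuclideanSpace ℝ (Fin d))}
  {φ ψ : EuclideanSpace ℝ (Fin d) → ℝ}

/-- Absorbs the additive 2 from the Hessian of ‖y‖². If R < 1 then λ ≤ R² ≤ R, so λ^(K-1) ≤ R^(K-2)
R². -/
theorem one_le_max_bound (hR : 0 < R) (hlam : 0 < lam) (h : min 1 lam ≤ R ^ 2) {K : ℕ}
    (hK : 2 ≤ K) : 1 ≤ max (R ^ 2) (R ^ K / lam ^ (K - 1)) := by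
  rcases le_or_gt 1 (R ^ 2) with h1 | h1
  · exact h1.trans (le_max_left _ _)
  · refine le_trans ?_ (le_max_right _ _)
    have hR1 : R ≤ 1 := by nlinarith
    have hl : lam ≤ R ^ 2 := (min_le_iff.1 h).resolve_left (not_le.2 h1)
    obtain ⟨k, rfl⟩ := Nat.exists_eq_add_of_le' hK
    rw [Nat.add_sub_assoc one_le_two, one_le_div (by positivity)]
    calc lam ^ (k + 1) = lam ^ k * lam := pow_succ _ _
      _ ≤ R ^ k * R ^ 2 := by gcongr; nlinarith
      _ = _ := by ring

/-- The left side is R (R/λ)ⁿ. For R > λ it increases with n, so the top order dominates. For R ≤ λ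
it is at most R, and the condition on R² then forces R ≥ 1, so R ≤ R². -/
theorem pow_div_le_max_bound (hR : 0 < R) (hlam : 0 < lam) {K : ℕ}
    (h : K = 1 ∨ min 1 lam ≤ R ^ 2) {n : ℕ} (hn : n + 1 ≤ K) :
    R ^ (n + 1) / lam ^ n ≤ max (R ^ 2) (R ^ K / lam ^ (K - 1)) := by
  obtain ⟨k, rfl⟩ := Nat.exists_eq_add_of_le' (le_of_add_le_right hn)
  have e : ∀ j : ℕ, R ^ (j + 1) / lam ^ j = R * (R / lam) ^ j := fun j => by
    rw [div_pow]
    ring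
  rw [Nat.add_sub_cancel, e, e]
  rcases h with h | h
  · obtain rfl : k = 0 := by omega
    obtain rfl : n = 0 := by omega
    exact le_max_right _ _
  · rcases le_or_gt R lam with h1 | h1
    · refine le_trans ?_ (le_max_left _ _)
      have h2 : 1 ≤ R := by
        rcases min_le_iff.1 h with h2 | h2 <;> nlinarith
      calc R * (R / lam) ^ n ≤ R * 1 := by
            gcongr
            exact pow_le_one₀ (by positivity) ((div_le_one hlam).2 h1)
        _ ≤ R ^ 2 := by nlinarith
    · refine le_trans ?_ (le_max_right _ _)
      gcongr
      · exact (one_le_div hlam).2 h1.le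
      · omega

/-- The constants in the bounds on the derivatives of the potential. -/
noncomputable def potentialConst (K : ℕ) : ℝ :=
  4 + ∑ n ∈ Finset.range K, (2 + gibbsConst n * 2 ^ (n + 1))

theorem four_le_potentialConst (K : ℕ) : 4 ≤ potentialConst K :=
  le_add_of_nonneg_right (Finset.sum_nonneg fun n _ =>
    add_nonneg zero_le_two (mul_nonneg (gibbsConst_nonneg n) (by positivity)))

theorem le_potentialConst {n K : ℕ} (hn : n < K) :
    2 + gibbsConst n * 2 ^ (n + 1) ≤ potentialConst K := by
  have h := Finset.single_le_sum (f := fun n => 2 + gibbsConst n * 2 ^ (n + 1))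
    (fun n _ => add_nonneg zero_le_two (mul_nonneg (gibbsConst_nonneg n) (by positivity)))
    (Finset.mem_range.2 hn)
  exact h.trans (le_add_of_nonneg_left zero_le_four)

theorem norm_multiPartialWithin_cTransform_le [IsProbabilityMeasure μ] (hR : 0 < R)
    (hlam : 0 < lam) (hμ : ∀ᵐ x ∂μ, ‖x‖ ≤ R) (hφ : MemLp φ ∞ μ) (h0 : ψ 0 = 0)
    (hψ : Set.EqOn ψ (cTransform lam μ φ) (closedBall 0 R)) {K : ℕ} (hK : 1 ≤ K)
    (h : K = 1 ∨ min 1 lam ≤ R ^ 2) {κ : Fin d → ℕ} (hκ : ∑ i, κ i ≤ K)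
    {y : EuclideanSpace ℝ (Fin d)} (hy : y ∈ closedBall 0 R) :
    ‖multiPartialWithin (closedBall 0 R) κ ψ y‖ ≤
      potentialConst K * max (R ^ 2) (R ^ K / lam ^ (K - 1)) := by
  have hs : UniqueDiffOn ℝ (closedBall (0 : EuclideanSpace ℝ (Fin d)) R) :=
    uniqueDiffOn_convex (convex_closedBall _ _) ⟨0, by
      rw [mem_interior_iff_mem_nhds]
      exact closedBall_mem_nhds _ hR⟩
  have hyR := mem_closedBall_zero_iff.1 hy
  set T := max (R ^ 2) (R ^ K / lam ^ (K - 1)) with hT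
  have hT0 : 0 ≤ T := (by positivity : 0 ≤ R ^ 2).trans (le_max_left _ _)
  rcases Nat.eq_zero_or_pos (∑ i, κ i) with hj | hj
  · have hκ0 : κ = 0 := by
      ext i
      exact Finset.sum_eq_zero_iff.1 hj i (Finset.mem_univ i)
    have h5 : multiPartialWithin (closedBall 0 R) κ ψ y = ψ y := by
      simp [hκ0, multiPartialWithin]
    -- At order zero the normalization ψ(0) = 0 turns the Lipschitz estimate into a sup bound.
    have h6 := abs_cTransform_sub_le hlam hμ hφ hyR (norm_zero.trans_le hR.le)
    rw [← hψ hy, ← hψ (mem_closedBall_self hR.le), h0, sub_zero, sub_zero] at h6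
    rw [h5]
    calc ‖ψ y‖ ≤ 4 * R * ‖y‖ := h6
      _ ≤ 4 * R * R := by gcongr
      _ = 4 * R ^ 2 := by ring
      _ ≤ _ := mul_le_mul (four_le_potentialConst K) (le_max_left _ _) (by positivity)
        (zero_le_four.trans (four_le_potentialConst K))
  · refine (norm_multiPartialWithin_le hs (contDiff_cTransform hlam hμ hφ) hψ κ hy).trans ?_
    generalize (∑ i, κ i) = j at *
    obtain ⟨n, rfl⟩ := Nat.exists_eq_add_of_le' hj
    rcases n with _ | n
    · rw [zero_add, norm_iteratedFDeriv_one]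
      refine (norm_fderiv_cTransform_le hlam hμ hφ hyR).trans ?_
      have h7 := pow_div_le_max_bound hR hlam h hκ
      rw [zero_add, pow_one, pow_zero, div_one] at h7
      exact mul_le_mul (four_le_potentialConst K) h7 hR.le
        (zero_le_four.trans (four_le_potentialConst K))
    · refine (norm_iteratedFDeriv_cTransform_le hlam hμ hφ n y).trans ?_
      have h7 := pow_div_le_max_bound hR hlam h hκ
      have h8 := one_le_max_bound hR hlam (h.resolve_left (by omega)) (by omega : 2 ≤ K)
      have h9 : 0 ≤ gibbsConst (n + 1) * 2 ^ (n + 2) :=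
        mul_nonneg (gibbsConst_nonneg _) (by positivity)
      calc _ ≤ 2 * T + gibbsConst (n + 1) * 2 ^ (n + 2) * T :=
            add_le_add (by linarith) (mul_le_mul_of_nonneg_left h7 h9)
        _ = (2 + gibbsConst (n + 1) * 2 ^ (n + 2)) * T := by ring
        _ ≤ _ := mul_le_mul_of_nonneg_right (le_potentialConst (by omega)) hT0

end Bounds

end EntropicOT

namespace EntropicOT

/-! ### The semi-dual functional and alternating maximization -/

section Duality

variable {d : ℕ} {R lam : ℝ} {μ ν : Measure (EuclideanSpace ℝ (Fin d))}
  {f g φ : EuclideanSpace ℝ (Fin d) → ℝ}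

theorem exp_neg_cTransform [IsProbabilityMeasure μ] (hlam : 0 < lam) (hφ : MemLp φ ∞ μ)
    (y : EuclideanSpace ℝ (Fin d)) : Real.exp (-cTransform lam μ φ y / lam) =
      ∫ x, Real.exp (-(‖x - y‖ ^ 2 - φ x) / lam) ∂μ := by
  rw [cTransform, neg_mul, neg_neg, mul_div_cancel_left₀ _ hlam.ne',
    Real.exp_log (integral_exp_pos (integrable_exp_cost hlam hφ y))]

theorem cTransform_congr_ae (h : f =ᵐ[μ] g) : cTransform lam μ f = cTransform lam μ g := by
  ext y
  rw [cTransform, cTransform]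
  congr 2
  refine integral_congr_ae ?_
  filter_upwards [h] with x hx
  rw [hx]

theorem cTransform_add_const [IsProbabilityMeasure μ] (hlam : 0 < lam) (hφ : MemLp φ ∞ μ) (a : ℝ)
    (y : EuclideanSpace ℝ (Fin d)) :
    cTransform lam μ (fun x => φ x + a) y = cTransform lam μ φ y - a := by
  have h1 : ∀ x, Real.exp (-(‖x - y‖ ^ 2 - (φ x + a)) / lam) =
      Real.exp (-(‖x - y‖ ^ 2 - φ x) / lam) * Real.exp (a / lam) := fun x => by
    rw [← Real.exp_add]
    congr 1
    ring
  rw [cTransform, cTransform]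
  simp_rw [h1, integral_mul_const]
  rw [Real.log_mul (integral_exp_pos (integrable_exp_cost hlam hφ y)).ne' (Real.exp_ne_zero _),
    Real.log_exp]
  field_simp
  ring

theorem memLp_add_const [IsFiniteMeasure μ] (hφ : MemLp φ ∞ μ) (a : ℝ) :
    MemLp (fun x => φ x + a) ∞ μ :=
  hφ.add (memLp_const a)

theorem cTransform_anti [IsProbabilityMeasure μ] (hlam : 0 < lam) (hf : MemLp f ∞ μ)
    (hg : MemLp g ∞ μ) (h : f ≤ᵐ[μ] g) (y : EuclideanSpace ℝ (Fin d)) :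
    cTransform lam μ g y ≤ cTransform lam μ f y := by
  rw [cTransform, cTransform, neg_mul, neg_mul, neg_le_neg_iff]
  refine mul_le_mul_of_nonneg_left (Real.log_le_log
    (integral_exp_pos (integrable_exp_cost hlam hf y))
    (integral_mono_ae (integrable_exp_cost hlam hf y) (integrable_exp_cost hlam hg y) ?_)) hlam.le
  filter_upwards [h] with x hx
  exact Real.exp_le_exp.2 (by gcongr)

/-- The transform reverses order and turns adding a constant into subtracting it; apply both to g ≤
f + ε. -/
theorem cTransform_sub_le [IsProbabilityMeasure μ] (hlam : 0 < lam) (hf : MemLp f ∞ μ)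
    (hg : MemLp g ∞ μ) {ε : ℝ} (h : ∀ᵐ x ∂μ, |f x - g x| ≤ ε) (y : EuclideanSpace ℝ (Fin d)) :
    cTransform lam μ f y - cTransform lam μ g y ≤ ε := by
  have h1 := cTransform_anti hlam hg (memLp_add_const hf ε) (by
    filter_upwards [h] with x hx
    linarith [(abs_le.1 hx).1]) y
  rw [cTransform_add_const hlam hf] at h1
  linarith

theorem abs_cTransform_sub_cTransform_le [IsProbabilityMeasure μ] (hlam : 0 < lam)
    (hf : MemLp f ∞ μ) (hg : MemLp g ∞ μ) {ε : ℝ} (h : ∀ᵐ x ∂μ, |f x - g x| ≤ ε)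
    (y : EuclideanSpace ℝ (Fin d)) : |cTransform lam μ f y - cTransform lam μ g y| ≤ ε := by
  have h1 := cTransform_sub_le hlam hf hg h y
  have h2 := cTransform_sub_le hlam hg hf (by simpa only [abs_sub_comm] using h) y
  exact abs_le.2 ⟨by linarith, h1⟩

theorem memLp_cTransform [IsProbabilityMeasure μ] [IsProbabilityMeasure ν] (hlam : 0 < lam)
    (hR : 0 < R) (hμ : ∀ᵐ x ∂μ, ‖x‖ ≤ R) (hν : ∀ᵐ x ∂ν, ‖x‖ ≤ R) (hφ : MemLp φ ∞ μ) :
    MemLp (cTransform lam μ φ) ∞ ν := by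
  refine memLp_top_of_bound
    (contDiff_cTransform hlam hμ hφ).continuous.aestronglyMeasurable
    (|cTransform lam μ φ 0| + 4 * R * R) ?_
  filter_upwards [hν] with y hy
  have h1 := abs_cTransform_sub_le hlam hμ hφ hy (norm_zero.trans_le hR.le)
  rw [sub_zero] at h1
  have h2 : 4 * R * ‖y‖ ≤ 4 * R * R := by gcongr
  have h3 := abs_sub_abs_le_abs_sub (cTransform lam μ φ y) (cTransform lam μ φ 0)
  rw [Real.norm_eq_abs]
  linarith

theorem integrable_dualObjective [IsProbabilityMeasure μ] [IsProbabilityMeasure ν]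
    (hlam : 0 < lam) (hf : MemLp f ∞ μ) (hg : MemLp g ∞ ν) :
    Integrable (fun z : EuclideanSpace ℝ (Fin d) × EuclideanSpace ℝ (Fin d) =>
      lam * (Real.exp ((f z.1 + g z.2 - ‖z.1 - z.2‖ ^ 2) / lam) - 1)) (μ.prod ν) := by
  obtain ⟨C, hC⟩ := exists_ae_norm_le hf
  obtain ⟨D, hD⟩ := exists_ae_norm_le hg
  have hm : AEStronglyMeasurable
      (fun z : EuclideanSpace ℝ (Fin d) × EuclideanSpace ℝ (Fin d) =>
        (f z.1 + g z.2 - ‖z.1 - z.2‖ ^ 2) / lam) (μ.prod ν) := by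
    have h1 : AEStronglyMeasurable (fun z : EuclideanSpace ℝ (Fin d) × EuclideanSpace ℝ (Fin d) =>
        ‖z.1 - z.2‖ ^ 2) (μ.prod ν) :=
      (by fun_prop : Continuous fun z : EuclideanSpace ℝ (Fin d) × EuclideanSpace ℝ (Fin d) =>
        ‖z.1 - z.2‖ ^ 2).aestronglyMeasurable
    exact (((hf.1.comp_fst.add hg.1.comp_snd).sub h1).aemeasurable.div_const
      lam).aestronglyMeasurable
  refine ((Integrable.of_bound (Real.continuous_exp.comp_aestronglyMeasurable hm)
    (Real.exp ((C + D) / lam)) ?_).sub (integrable_const 1)).const_mul lam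
  filter_upwards [Measure.quasiMeasurePreserving_fst.ae hC,
    Measure.quasiMeasurePreserving_snd.ae hD] with z h1 h2
  rw [Real.norm_of_nonneg (Real.exp_pos _).le, Real.exp_le_exp]
  rw [Real.norm_eq_abs] at h1 h2
  gcongr
  nlinarith [le_abs_self (f z.1), le_abs_self (g z.2), sq_nonneg ‖z.1 - z.2‖]

theorem integral_dualObjective_eq [IsProbabilityMeasure ν] (hlam : 0 < lam) (hg : MemLp g ∞ ν)
    (x : EuclideanSpace ℝ (Fin d)) (a : ℝ) :
    ∫ y, lam * (Real.exp ((a + g y - ‖x - y‖ ^ 2) / lam) - 1) ∂ν =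
      lam * (Real.exp ((a - cTransform lam ν g x) / lam) - 1) := by
  have h1 : ∀ y, Real.exp ((a + g y - ‖x - y‖ ^ 2) / lam) =
      Real.exp (a / lam) * Real.exp (-(‖y - x‖ ^ 2 - g y) / lam) := fun y => by
    rw [← Real.exp_add, norm_sub_rev]
    congr 1
    ring
  simp_rw [h1]
  rw [integral_const_mul, integral_sub ((integrable_exp_cost hlam hg x).const_mul _)
    (integrable_const _), integral_const_mul, ← exp_neg_cTransform hlam hg, ← Real.exp_add]
  simp only [integral_const, probReal_univ, smul_eq_mul, mul_one]
  congr 3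
  ring

/-- The dual objective after partial maximization in the first variable. -/
noncomputable def semiDual (lam : ℝ) (μ ν : Measure (EuclideanSpace ℝ (Fin d)))
    (g : EuclideanSpace ℝ (Fin d) → ℝ) : ℝ :=
  ∫ x, cTransform lam ν g x ∂μ + ∫ y, g y ∂ν

theorem dualObjective_eq [IsProbabilityMeasure μ] [IsProbabilityMeasure ν]
    (hlam : 0 < lam) (hf : MemLp f ∞ μ) (hg : MemLp g ∞ ν) :
    dualObjective lam μ ν f g = ∫ x, f x ∂μ + ∫ y, g y ∂ν -
      ∫ x, lam * (Real.exp ((f x - cTransform lam ν g x) / lam) - 1) ∂μ := by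
  rw [dualObjective, integral_prod _ (integrable_dualObjective hlam hf hg)]
  simp_rw [integral_dualObjective_eq hlam hg]

theorem dualObjective_cTransform_left [IsProbabilityMeasure μ] [IsProbabilityMeasure ν]
    (hlam : 0 < lam) (hR : 0 < R) (hμ : ∀ᵐ x ∂μ, ‖x‖ ≤ R) (hν : ∀ᵐ x ∂ν, ‖x‖ ≤ R)
    (hg : MemLp g ∞ ν) :
    dualObjective lam μ ν (cTransform lam ν g) g = semiDual lam μ ν g := by
  rw [dualObjective_eq hlam (memLp_cTransform hlam hR hν hμ hg) hg, semiDual]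
  simp

/-- Integrate out `y`, then apply t ≤ λ(exp(t/λ) - 1) with t = f - `cTransform lam ν g`. Equality
holds at t = 0, so the c-transform is the best first variable. -/
theorem dualObjective_le_semiDual [IsProbabilityMeasure μ] [IsProbabilityMeasure ν]
    (hlam : 0 < lam) (hR : 0 < R) (hμ : ∀ᵐ x ∂μ, ‖x‖ ≤ R) (hν : ∀ᵐ x ∂ν, ‖x‖ ≤ R)
    (hf : MemLp f ∞ μ) (hg : MemLp g ∞ ν) :
    dualObjective lam μ ν f g ≤ semiDual lam μ ν g := by
  have ht := memLp_cTransform hlam hR hν hμ hg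
  have hint := (integrable_dualObjective hlam hf hg).integral_prod_left
  simp_rw [integral_dualObjective_eq hlam hg] at hint
  have h1 : ∫ x, f x - cTransform lam ν g x ∂μ ≤
      ∫ x, lam * (Real.exp ((f x - cTransform lam ν g x) / lam) - 1) ∂μ := by
    refine integral_mono ((hf.integrable le_top).sub (ht.integrable le_top)) hint fun x => ?_
    have h2 := Real.add_one_le_exp ((f x - cTransform lam ν g x) / lam)
    calc f x - cTransform lam ν g x = lam * ((f x - cTransform lam ν g x) / lam) := by
          field_simp
      _ ≤ _ := mul_le_mul_of_nonneg_left (by linarith) hlam.le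
  rw [integral_sub (hf.integrable le_top) (ht.integrable le_top)] at h1
  rw [dualObjective_eq hlam hf hg, semiDual]
  linarith

theorem dualObjective_comm [IsProbabilityMeasure μ] [IsProbabilityMeasure ν] :
    dualObjective lam μ ν f g = dualObjective lam ν μ g f := by
  rw [dualObjective, dualObjective, ← integral_prod_swap, add_comm (∫ x, f x ∂μ)]
  simp only [Prod.fst_swap, Prod.snd_swap, add_comm (f _), norm_sub_rev]

/-- This invariance is what permits the normalization ψ(0) = 0. -/
theorem dualObjective_add_sub [IsProbabilityMeasure μ] [IsProbabilityMeasure ν]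
    (hf : MemLp f ∞ μ) (hg : MemLp g ∞ ν) (a : ℝ) :
    dualObjective lam μ ν (fun x => f x + a) (fun y => g y - a) = dualObjective lam μ ν f g := by
  rw [dualObjective, dualObjective, integral_add (hf.integrable le_top) (integrable_const a),
    integral_sub (hg.integrable le_top) (integrable_const a)]
  simp only [integral_const, probReal_univ, smul_eq_mul, one_mul, add_add_sub_cancel]

theorem dualObjective_le_cTransform_right [IsProbabilityMeasure μ] [IsProbabilityMeasure ν]
    (hlam : 0 < lam) (hR : 0 < R) (hμ : ∀ᵐ x ∂μ, ‖x‖ ≤ R) (hν : ∀ᵐ x ∂ν, ‖x‖ ≤ R)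
    (hf : MemLp f ∞ μ) (hg : MemLp g ∞ ν) :
    dualObjective lam μ ν f g ≤ dualObjective lam μ ν f (cTransform lam μ f) := by
  rw [dualObjective_comm, dualObjective_comm (g := cTransform lam μ f),
    dualObjective_cTransform_left hlam hR hν hμ hf]
  exact dualObjective_le_semiDual hlam hR hν hμ hg hf

theorem semiDual_congr_ae (h : f =ᵐ[ν] g) : semiDual lam μ ν f = semiDual lam μ ν g := by
  rw [semiDual, semiDual, cTransform_congr_ae h, integral_congr_ae h]

theorem abs_semiDual_sub_le [IsProbabilityMeasure μ] [IsProbabilityMeasure ν]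
    (hlam : 0 < lam) (hR : 0 < R) (hμ : ∀ᵐ x ∂μ, ‖x‖ ≤ R) (hν : ∀ᵐ x ∂ν, ‖x‖ ≤ R)
    (hf : MemLp f ∞ ν) (hg : MemLp g ∞ ν) {ε : ℝ} (h : ∀ᵐ x ∂ν, |f x - g x| ≤ ε) :
    |semiDual lam μ ν f - semiDual lam μ ν g| ≤ 2 * ε := by
  have key : ∀ {ρ : Measure (EuclideanSpace ℝ (Fin d))} [IsProbabilityMeasure ρ]
      {u v : EuclideanSpace ℝ (Fin d) → ℝ}, MemLp u ∞ ρ → MemLp v ∞ ρ →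
      (∀ᵐ x ∂ρ, |u x - v x| ≤ ε) → |∫ x, u x ∂ρ - ∫ x, v x ∂ρ| ≤ ε := by
    intro ρ _ u v hu hv huv
    rw [← integral_sub (hu.integrable le_top) (hv.integrable le_top)]
    simpa using norm_integral_le_of_norm_le_const (f := fun x => u x - v x) (C := ε) huv
  have h1 := key hf hg h
  have h2 := key (memLp_cTransform hlam hR hν hμ hf) (memLp_cTransform hlam hR hν hμ hg)
    (Filter.Eventually.of_forall fun x => abs_cTransform_sub_cTransform_le hlam hf hg h x)
  rw [semiDual, semiDual, add_sub_add_comm, two_mul]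
  exact (abs_add_le _ _).trans (add_le_add h2 h1)

end Duality

/-! ### Existence of potentials by compactness -/

section Existence

open scoped BoundedContinuousFunction

variable {d : ℕ} {R lam : ℝ} {μ ν : Measure (EuclideanSpace ℝ (Fin d))}

/-- Bounded continuous functions on the ball which vanish at the origin and are `C`-Lipschitz. -/
def lipschitzBall (d : ℕ) {R : ℝ} (hR : 0 ≤ R) (C : ℝ) :
    Set (closedBall (0 : EuclideanSpace ℝ (Fin d)) R →ᵇ ℝ) :=
  {u | u ⟨0, mem_closedBall_self hR⟩ = 0 ∧ ∀ x y, |u x - u y| ≤ C * dist x y}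

theorem isCompact_lipschitzBall (hR : 0 ≤ R) {C : ℝ} (hC : 0 ≤ C) :
    IsCompact (lipschitzBall d hR C) := by
  have : CompactSpace (closedBall (0 : EuclideanSpace ℝ (Fin d)) R) :=
    isCompact_iff_compactSpace.1 (isCompact_closedBall _ _)
  -- Vanishing at 0 and being C-Lipschitz on a ball of radius R confines all values to [-CR, CR].
  refine BoundedContinuousFunction.arzela_ascoli₂ (closedBall 0 (C * R))
    (isCompact_closedBall _ _) _ ?_ ?_ ?_
  · have hev : ∀ x, Continuous fun u : closedBall (0 : EuclideanSpace ℝ (Fin d)) R →ᵇ ℝ => u x :=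
      fun x => continuous_eval_const x
    have hset : lipschitzBall d hR C = {u | u ⟨0, mem_closedBall_self hR⟩ = 0} ∩
        ⋂ x, ⋂ y, {u | |u x - u y| ≤ C * dist x y} := by
      ext u
      simp [lipschitzBall]
    rw [hset]
    exact (isClosed_eq (hev _) continuous_const).inter (isClosed_iInter fun x =>
      isClosed_iInter fun y => isClosed_le ((hev x).sub (hev y)).abs continuous_const)
  · intro u x hu
    have h1 := hu.2 x ⟨0, mem_closedBall_self hR⟩
    rw [hu.1, sub_zero] at h1
    rw [mem_closedBall_zero_iff, Real.norm_eq_abs]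
    refine h1.trans ?_
    gcongr
    exact x.2
  · refine (LipschitzWith.uniformEquicontinuous _ C.toNNReal fun u =>
      LipschitzWith.of_dist_le_mul fun x y => ?_).equicontinuous
    rw [Real.coe_toNNReal _ hC, Real.dist_eq]
    exact u.2.2 x y

/-- The extension by zero of a function on the ball. -/
noncomputable def extendBall (u : closedBall (0 : EuclideanSpace ℝ (Fin d)) R →ᵇ ℝ) :
    EuclideanSpace ℝ (Fin d) → ℝ :=
  Function.extend Subtype.val u 0

theorem extendBall_apply (u : closedBall (0 : EuclideanSpace ℝ (Fin d)) R →ᵇ ℝ)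
    {x : EuclideanSpace ℝ (Fin d)} (hx : x ∈ closedBall 0 R) : extendBall u x = u ⟨x, hx⟩ :=
  Subtype.val_injective.extend_apply u 0 ⟨x, hx⟩

theorem memLp_extendBall (hν : ∀ᵐ x ∂ν, ‖x‖ ≤ R)
    (u : closedBall (0 : EuclideanSpace ℝ (Fin d)) R →ᵇ ℝ) : MemLp (extendBall u) ∞ ν := by
  refine memLp_top_of_bound
    ((MeasurableEmbedding.subtype_coe isClosed_closedBall.measurableSet).measurable_extend
      u.continuous.measurable measurable_zero).aestronglyMeasurable ‖u‖ ?_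
  filter_upwards [hν] with x hx
  rw [extendBall_apply u (mem_closedBall_zero_iff.2 hx)]
  exact u.norm_coe_le_norm _

theorem exists_lipschitzBall_eqOn (hR : 0 ≤ R) {C : ℝ} (hC : 0 ≤ C)
    {ψ : EuclideanSpace ℝ (Fin d) → ℝ} (h0 : ψ 0 = 0)
    (h : ∀ x ∈ closedBall 0 R, ∀ y ∈ closedBall 0 R, |ψ x - ψ y| ≤ C * ‖x - y‖) :
    ∃ u ∈ lipschitzBall d hR C, Set.EqOn (extendBall u) ψ (closedBall 0 R) := by
  have : CompactSpace (closedBall (0 : EuclideanSpace ℝ (Fin d)) R) :=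
    isCompact_iff_compactSpace.1 (isCompact_closedBall _ _)
  have hlip : ∀ x y : closedBall (0 : EuclideanSpace ℝ (Fin d)) R,
      |ψ x - ψ y| ≤ C * dist x y := fun x y => by
    rw [Subtype.dist_eq, dist_eq_norm]
    exact h x x.2 y y.2
  have hcont : Continuous fun x : closedBall (0 : EuclideanSpace ℝ (Fin d)) R => ψ x :=
    (LipschitzWith.of_dist_le_mul (K := C.toNNReal) fun x y => by
      rw [Real.coe_toNNReal _ hC, Real.dist_eq]
      exact hlip x y).continuous
  exact ⟨BoundedContinuousFunction.mkOfCompact ⟨_, hcont⟩, ⟨h0, hlip⟩,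
    fun x hx => extendBall_apply _ hx⟩

theorem exists_isMaxOn_semiDual [IsProbabilityMeasure μ] [IsProbabilityMeasure ν]
    (hlam : 0 < lam) (hR : 0 < R) (hμ : ∀ᵐ x ∂μ, ‖x‖ ≤ R) (hν : ∀ᵐ x ∂ν, ‖x‖ ≤ R) :
    ∃ u ∈ lipschitzBall d hR.le (4 * R), ∀ v ∈ lipschitzBall d hR.le (4 * R),
      semiDual lam μ ν (extendBall v) ≤ semiDual lam μ ν (extendBall u) := by
  refine (isCompact_lipschitzBall hR.le (by positivity)).exists_isMaxOn
    (f := fun u => semiDual lam μ ν (extendBall u)) ⟨0, by simp, fun x y => ?_⟩ ?_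
  · simp only [BoundedContinuousFunction.coe_zero, Pi.zero_apply, sub_zero, abs_zero]
    positivity
  refine (LipschitzWith.of_dist_le_mul (K := 2) fun u v => ?_).continuous.continuousOn
  rw [Real.dist_eq]
  refine abs_semiDual_sub_le hlam hR hμ hν (memLp_extendBall hν u) (memLp_extendBall hν v) ?_
  filter_upwards [hν] with x hx
  rw [extendBall_apply u (mem_closedBall_zero_iff.2 hx),
    extendBall_apply v (mem_closedBall_zero_iff.2 hx), ← Real.dist_eq]
  exact BoundedContinuousFunction.dist_coe_le_dist _

/-- The semi-dual maximizer `g₀` need not itself be a c-transform everywhere on the ball. Two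
further transforms produce φ₀ and ψ₀ without lowering the objective, and a constant shift normalizes
ψ₀. -/
theorem exists_isDualPotentials [IsProbabilityMeasure μ] [IsProbabilityMeasure ν]
    (hlam : 0 < lam) (hR : 0 < R) (hμ : ∀ᵐ x ∂μ, ‖x‖ ≤ R) (hν : ∀ᵐ x ∂ν, ‖x‖ ≤ R) :
    ∃ φ ψ : EuclideanSpace ℝ (Fin d) → ℝ, IsDualPotentials lam μ ν φ ψ ∧ ψ 0 = 0 ∧
      ψ = cTransform lam μ φ := by
  obtain ⟨u, -, hu⟩ := exists_isMaxOn_semiDual hlam hR hμ hν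
  set g₀ := extendBall u
  have hg₀ : MemLp g₀ ∞ ν := memLp_extendBall hν u
  set φ₀ := cTransform lam ν g₀
  have hφ₀ : MemLp φ₀ ∞ μ := memLp_cTransform hlam hR hν hμ hg₀
  set ψ₀ := cTransform lam μ φ₀
  have hψ₀ : MemLp ψ₀ ∞ ν := memLp_cTransform hlam hR hμ hν hφ₀
  have hψ : cTransform lam μ (fun x => φ₀ x + ψ₀ 0) = fun y => ψ₀ y - ψ₀ 0 :=
    funext fun y => cTransform_add_const hlam hφ₀ _ y
  refine ⟨fun x => φ₀ x + ψ₀ 0, fun y => ψ₀ y - ψ₀ 0,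
    ⟨memLp_add_const hφ₀ _, hψ₀.sub (memLp_const _), fun f g hf hg => ?_⟩, sub_self _, hψ.symm⟩
  rw [dualObjective_add_sub hφ₀ hψ₀]
  have h1 : MemLp (cTransform lam ν g) ∞ μ := memLp_cTransform hlam hR hν hμ hg
  set φ₁ := cTransform lam ν g
  set ψ₁ := cTransform lam μ φ₁
  have h2 : MemLp ψ₁ ∞ ν := memLp_cTransform hlam hR hμ hν h1
  -- An arbitrary competitor, improved by two c-transforms and shifted, enters the compact class,
  -- where it can be compared with `g₀`.
  obtain ⟨v, hv, hvψ⟩ := exists_lipschitzBall_eqOn (ψ := fun y => ψ₁ y - ψ₁ 0) hR.le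
    (by positivity : 0 ≤ 4 * R) (sub_self _) (fun x hx y hy => by
      rw [sub_sub_sub_cancel_right]
      exact abs_cTransform_sub_le hlam hμ h1 (mem_closedBall_zero_iff.1 hx)
        (mem_closedBall_zero_iff.1 hy))
  have h3 : extendBall v =ᵐ[ν] fun y => ψ₁ y - ψ₁ 0 := by
    filter_upwards [hν] with x hx using hvψ (mem_closedBall_zero_iff.2 hx)
  calc dualObjective lam μ ν f g ≤ semiDual lam μ ν g :=
        dualObjective_le_semiDual hlam hR hμ hν hf hg
    _ = dualObjective lam μ ν φ₁ g := (dualObjective_cTransform_left hlam hR hμ hν hg).symm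
    _ ≤ dualObjective lam μ ν φ₁ ψ₁ := dualObjective_le_cTransform_right hlam hR hμ hν h1 hg
    _ = dualObjective lam μ ν (fun x => φ₁ x + ψ₁ 0) (fun y => ψ₁ y - ψ₁ 0) :=
        (dualObjective_add_sub h1 h2 _).symm
    _ ≤ semiDual lam μ ν (fun y => ψ₁ y - ψ₁ 0) :=
        dualObjective_le_semiDual hlam hR hμ hν (memLp_add_const h1 _)
          (h2.sub (memLp_const _))
    _ = semiDual lam μ ν (extendBall v) := (semiDual_congr_ae h3).symm
    _ ≤ semiDual lam μ ν g₀ := hu v hv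
    _ = dualObjective lam μ ν φ₀ g₀ := (dualObjective_cTransform_left hlam hR hμ hν hg₀).symm
    _ ≤ dualObjective lam μ ν φ₀ ψ₀ := dualObjective_le_cTransform_right hlam hR hμ hν hφ₀ hg₀

end Existence

/-! ### Mass and support of the mixture -/

section Mixture

variable {d m : ℕ} {R : ℝ} {μ : Fin m → Measure (EuclideanSpace ℝ (Fin d))} {θ : Fin m → ℝ}

theorem ae_norm_le_of_support_subset {ν : Measure (EuclideanSpace ℝ (Fin d))}
    (h : ν.support ⊆ closedBall 0 R) : ∀ᵐ x ∂ν, ‖x‖ ≤ R := by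
  filter_upwards [ν.support_mem_ae] with x hx using mem_closedBall_zero_iff.1 (h hx)

theorem isProbabilityMeasure_mixture (hμ : ∀ k, IsProbabilityMeasure (μ k))
    (hθ : θ ∈ stdSimplex ℝ (Fin m)) : IsProbabilityMeasure (mixture μ θ) := by
  refine ⟨?_⟩
  simp only [mixture, Measure.coe_finsetSum, Finset.sum_apply, Measure.smul_apply, measure_univ,
    smul_eq_mul, mul_one]
  rw [← ENNReal.ofReal_sum_of_nonneg fun k _ => hθ.1 k, hθ.2, ENNReal.ofReal_one]

theorem ae_norm_le_mixture (h : ∀ k, (μ k).support ⊆ closedBall 0 R) :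
    ∀ᵐ x ∂(mixture μ θ), ‖x‖ ≤ R := by
  rw [ae_iff]
  simp only [mixture, Measure.coe_finsetSum, Finset.sum_apply, Measure.smul_apply, smul_eq_mul]
  refine Finset.sum_eq_zero fun k _ => ?_
  rw [ae_iff.1 (ae_norm_le_of_support_subset (h k)), mul_zero]

end Mixture

end EntropicOT

theorem mainTheorem8 :
    ∃ M : ℕ → ℝ, (∀ K, 0 < M K) ∧
      ∀ (d m : ℕ) (R lam : ℝ), 0 < R → 0 < lam →
      ∀ (μ : Fin m → Measure (EuclideanSpace ℝ (Fin d)))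
        (ν : Measure (EuclideanSpace ℝ (Fin d))),
        (∀ k, IsProbabilityMeasure (μ k)) → IsProbabilityMeasure ν →
        (∀ k, (μ k).support ⊆ closedBall 0 R) → ν.support ⊆ closedBall 0 R →
      ∀ θ ∈ stdSimplex ℝ (Fin m),
        (∃ φ ψ : EuclideanSpace ℝ (Fin d) → ℝ,
          EntropicOT.IsDualPotentials lam (EntropicOT.mixture μ θ) ν φ ψ ∧ ψ 0 = 0 ∧
          ∀ y ∈ closedBall 0 R,
            ψ y = EntropicOT.cTransform lam (EntropicOT.mixture μ θ) φ y) ∧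
        ∀ φ ψ : EuclideanSpace ℝ (Fin d) → ℝ,
          EntropicOT.IsDualPotentials lam (EntropicOT.mixture μ θ) ν φ ψ → ψ 0 = 0 →
          (∀ y ∈ closedBall 0 R,
            ψ y = EntropicOT.cTransform lam (EntropicOT.mixture μ θ) φ y) →
          ContDiffOn ℝ ∞ ψ (closedBall 0 R) ∧
          ∀ K : ℕ, 1 ≤ K → (K = 1 ∨ min 1 lam ≤ R ^ 2) →
            EntropicOT.ckNorm (closedBall 0 R) K ψ
              ≤ ENNReal.ofReal (M K * max (R ^ 2) (R ^ K / lam ^ (K - 1))) := by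
  refine ⟨EntropicOT.potentialConst, fun K =>
    zero_lt_four.trans_le (EntropicOT.four_le_potentialConst K), ?_⟩
  intro d m R lam hR hlam μ ν hμ hν hμR hνR θ hθ
  have := EntropicOT.isProbabilityMeasure_mixture hμ hθ
  have hμ' := EntropicOT.ae_norm_le_mixture (θ := θ) hμR
  have hν' := EntropicOT.ae_norm_le_of_support_subset hνR
  refine ⟨?_, fun φ ψ hpot h0 hψ => ⟨?_, fun K hK h => ?_⟩⟩
  · obtain ⟨φ, ψ, h1, h2, h3⟩ := EntropicOT.exists_isDualPotentials hlam hR hμ' hν'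
    exact ⟨φ, ψ, h1, h2, fun y _ => congrFun h3 y⟩
  · exact (EntropicOT.contDiff_cTransform hlam hμ' hpot.memLp_left).contDiffOn.congr hψ
  · refine iSup_le fun κ => iSup_le fun hκ => iSup_le fun y => iSup_le fun hy => ?_
    rw [← ofReal_norm]
    exact ENNReal.ofReal_le_ofReal (EntropicOT.norm_multiPartialWithin_cTransform_le hR hlam hμ'
      hpot.memLp_left h0 hψ hK h hκ hy)
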